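/- Let $\Bbbk$ be an algebraically closed field; all algebras are finite dimensional associative unital $\Bbbk$-algebras. An algebra is hereditary if all its left ideals are projective. For a subalgebra $\mathbf A$ of a hereditary algebra $\mathbf H$ consider the conditions 1. $\operatorname{rad}\mathbf H\subseteq\mathbf A\subseteq\mathbf H$; 2. $\operatorname{rad}\mathbf A=\operatorname{rad}\mathbf H$; 3. $\operatorname{length}_{\mathbf A}(\mathbf H\otimes_{\mathbf A}U)\le 2$ for every simple left $\mathbf A$-module $U$; and - (3$'$) $\operatorname{length}_{\mathbf A}(U\otimes_{\mathbf A}\mathbf H)\le 2$ for every simple right $\mathbf A$-module $U$. Here $\operatorname{rad}$ is the Jacobson radical. The algebra $\mathbf A$ is called nodal if there is a hereditary algebra $\mathbf H$ containing $\mathbf A$ as a subalgebra such that (1), (2) and (3) hold; in this case $\mathbf A$ is said to be related to $\mathbf H$. Then: - If $\mathbf A$ is nodal, then its opposite algebra $\mathbf A^{\mathrm{op}}$ is nodal. - In the definition of nodal algebras condition (3) can be replaced by (3$'$): an algebra $\mathbf A$ is nodal if and only if there is a hereditary algebra $\mathbf H$ containing $\mathbf A$ such that (1), (2) and (3$'$)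 hold. Moreover, the relation to a given algebra is also unchanged: for every algebra $\mathbf A$, every algebra $\mathbf H$ and every embedding of $\mathbf A$ into $\mathbf H$ as a subalgebra, $\mathbf H$ is hereditary and (1), (2), (3) hold if and only if $\mathbf H$ is hereditary and (1), (2), (3$'$) hold. -/

import Mathlib

open scoped TensorProduct

universe u v w

namespace NodalAlg

/-- A ring is hereditary if all its left ideals are projective (as left modules).
`Ideal H` is the type of left ideals of `H`. For finite dimensional algebras this is
equivalent to the same condition on right ideals. -/
def IsHereditary (H : Type*) [Ring H] : Prop :=
  ∀ I : Ideal H, Module.Projective H I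

section Tensor

variable {A : Type*} {H : Type*} [Ring A] [Ring H]

/-! ### The left module `H ⊗_A U` for a left `A`-module `U`

Here `H` is a right `A`-module through `ι : A →+* H`. The tensor product over the
noncommutative ring `A` is the quotient of `H ⊗_ℤ U` by the subgroup generated by the
elements `(h · ι a) ⊗ u - h ⊗ (a · u)`. -/

/-- The subgroup of `H ⊗_ℤ U` generated by all `(h · ι a) ⊗ u - h ⊗ (a · u)`;
it is stable under left multiplication by `H`. -/
def leftRelations (ι : A →+* H) (U : Type*) [AddCommGroup U] [Module A U] :
    Submodule H (H ⊗[ℤ] U) where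
  __ := AddSubgroup.closure
    {z | ∃ (h : H) (a : A) (u : U), z = (h * ι a) ⊗ₜ[ℤ] u - h ⊗ₜ[ℤ] (a • u)}
  smul_mem' := by
    intro r z hz
    change z ∈ AddSubgroup.closure _ at hz
    change r • z ∈ AddSubgroup.closure _
    induction hz using AddSubgroup.closure_induction with
    | mem z hz =>
      obtain ⟨h, a, u, rfl⟩ := hz
      refine AddSubgroup.subset_closure ⟨r * h, a, u, ?_⟩
      simp [smul_sub, TensorProduct.smul_tmul', mul_assoc]
    | zero => simp
    | add x y _ _ hx hy => rw [smul_add]; exact add_mem hx hy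
    | neg x _ hx => rw [smul_neg]; exact neg_mem hx

/-- The left `H`-module `H ⊗_A U`. -/
abbrev LeftTensor (ι : A →+* H) (U : Type*) [AddCommGroup U] [Module A U] :=
  (H ⊗[ℤ] U) ⧸ leftRelations ι U

/-- The length of `H ⊗_A U` as a left `A`-module, where `A` acts by
`a · (h ⊗ u) = (ι a · h) ⊗ u`. -/
noncomputable def leftLength (ι : A →+* H) (U : Type*) [AddCommGroup U] [Module A U] : ℕ∞ :=
  letI : Module A (LeftTensor ι U) := Module.compHom (LeftTensor ι U) ι
  Module.length A (LeftTensor ι U)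

/-! ### The right module `U ⊗_A H` for a right `A`-module `U`

Right modules over `A` are modules over `Aᵐᵒᵖ`: `u · a` is `MulOpposite.op a • u`. -/

/-- The right `H`-module structure on `U ⊗_ℤ H`, given by `(u ⊗ h) · r = u ⊗ (h · r)`. -/
@[reducible] noncomputable def rightModule (H : Type*) [Ring H] (U : Type*) [AddCommGroup U] :
    Module Hᵐᵒᵖ (U ⊗[ℤ] H) :=
  Module.compHom (U ⊗[ℤ] H)
    ((Module.End.lTensorAlgHom ℤ H U).toRingHom.comp (Module.toModuleEnd ℤ (S := Hᵐᵒᵖ) H))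

theorem rightModule_smul_tmul (U : Type*) [AddCommGroup U] (r : H) (u : U) (h : H) :
    letI := rightModule H U
    MulOpposite.op r • (u ⊗ₜ[ℤ] h) = u ⊗ₜ[ℤ] (h * r) := rfl

/-- The subgroup of `U ⊗_ℤ H` generated by all `(u · a) ⊗ h - u ⊗ (ι a · h)`;
it is stable under right multiplication by `H`. -/
def rightRelations (ι : A →+* H) (U : Type*) [AddCommGroup U] [Module Aᵐᵒᵖ U] :
    letI := rightModule H U
    Submodule Hᵐᵒᵖ (U ⊗[ℤ] H) :=
  letI := rightModule H U
  { AddSubgroup.closure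
      {z | ∃ (u : U) (a : A) (h : H),
        z = (MulOpposite.op a • u) ⊗ₜ[ℤ] h - u ⊗ₜ[ℤ] (ι a * h)} with
    smul_mem' := by
      intro r z hz
      change z ∈ AddSubgroup.closure _ at hz
      change r • z ∈ AddSubgroup.closure _
      induction hz using AddSubgroup.closure_induction with
      | mem z hz =>
        obtain ⟨u, a, h, rfl⟩ := hz
        refine AddSubgroup.subset_closure ⟨u, a, h * r.unop, ?_⟩
        rw [smul_sub, ← MulOpposite.op_unop r, rightModule_smul_tmul, rightModule_smul_tmul]
        simp [mul_assoc]
      | zero => simp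
      | add x y _ _ hx hy => rw [smul_add]; exact add_mem hx hy
      | neg x _ hx => rw [smul_neg]; exact neg_mem hx }

/-- The abelian group `U ⊗_A H`. -/
abbrev RightTensor (ι : A →+* H) (U : Type*) [AddCommGroup U] [Module Aᵐᵒᵖ U] :=
  letI := rightModule H U
  (U ⊗[ℤ] H) ⧸ rightRelations ι U

/-- The length of `U ⊗_A H` as a right `A`-module, where `A` acts by
`(u ⊗ h) · a = u ⊗ (h · ι a)`. -/
noncomputable def rightLength (ι : A →+* H) (U : Type*) [AddCommGroup U] [Module Aᵐᵒᵖ U] : ℕ∞ :=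
  letI := rightModule H U
  letI : Module Aᵐᵒᵖ (RightTensor ι U) := Module.compHom (RightTensor ι U) (RingHom.op ι)
  Module.length Aᵐᵒᵖ (RightTensor ι U)

end Tensor

section Nodal

variable {k : Type u} {A : Type v} {H : Type w}
variable [Field k] [Ring A] [Algebra k A] [Ring H] [Algebra k H]

/-- `ι` embeds `A` as a subalgebra of the finite dimensional hereditary algebra `H`, and
`rad H ⊆ A ⊆ H`, `rad A = rad H`. -/
structure IsRadicalEmbedding (ι : A →ₐ[k] H) : Prop where
  finite : Module.Finite k H
  hereditary : IsHereditary H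
  injective : Function.Injective ι
  rad_subset : (Ring.jacobson H : Set H) ⊆ Set.range ι
  rad_eq : ι '' (Ring.jacobson A : Set A) = (Ring.jacobson H : Set H)

/-- The algebra `A`, embedded by `ι`, is nodal and related to the hereditary algebra `H`:
besides the conditions on radicals, `H ⊗_A U` has `A`-length at most two for every simple
left `A`-module `U`. (Every simple module is a quotient of `A`, so that those in the universe
of `A` are all of them up to isomorphism.) -/
structure IsNodalIn (ι : A →ₐ[k] H) : Prop extends IsRadicalEmbedding ι where
  length_le : ∀ (U : Type v) [AddCommGroup U] [Module A U],
    IsSimpleModule A U → leftLength (ι : A →+* H) U ≤ 2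

/-- The same as `IsNodalIn`, with the length condition replaced by: `U ⊗_A H` has `A`-length
at most two for every simple right `A`-module `U`. -/
structure IsRightNodalIn (ι : A →ₐ[k] H) : Prop extends IsRadicalEmbedding ι where
  length_le : ∀ (U : Type v) [AddCommGroup U] [Module Aᵐᵒᵖ U],
    IsSimpleModule Aᵐᵒᵖ U → rightLength (ι : A →+* H) U ≤ 2

end Nodal

/-- The `k`-algebra `A` is nodal. (`H` is finite dimensional and contains `A`, so that it
has a copy in the universe of `A`.) -/
def IsNodal (k : Type u) (A : Type v) [Field k] [Ring A] [Algebra k A] : Prop :=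
  ∃ (H : Type v) (_ : Ring H) (_ : Algebra k H) (ι : A →ₐ[k] H), IsNodalIn ι

/-- The notion obtained from `IsNodal` by replacing the condition on simple left modules
by the one on simple right modules. -/
def IsRightNodal (k : Type u) (A : Type v) [Field k] [Ring A] [Algebra k A] : Prop :=
  ∃ (H : Type v) (_ : Ring H) (_ : Algebra k H) (ι : A →ₐ[k] H), IsRightNodalIn ι

end NodalAlg

/-!
The length conditions only see the semisimple quotients `R = A / rad A ⊆ S = H / rad H`. A simple
right `A`-module `W` is `e R` for an idempotent `e`, and then `U = R e` is a simple left module,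
because semisimple rings are von Neumann regular. As `rad A = rad H` kills simple modules,
`H ⊗_A U` is `S e` and `W ⊗_A H` is `e S`. Since `k` is algebraically closed, `S` is a product of
matrix algebras, and the sum of their traces is a form `t` with `t (x y) = t (y x)` which represents
all functionals. The pairing `(x, y) ↦ t (y x)` of `S e` with `e S` is compatible with the actions
of `A`, so that taking orthogonal complements reverses inclusions of submodules strictly and the
`A`-length of `e S` is at most that of `S e`
(`NodalAlg.IsRadicalEmbedding.exists_rightLength_le`). Hence the condition on simple left modules
implies the one on simple right modules; the converse is the same statement for the opposite
algebras.

Passing to opposite algebras requires that heredity and the radical are left-right symmetric. For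
heredity (`NodalAlg.IsHereditary.op`) the `k`-dual of the regular right module is an injective left
module, and over a left hereditary ring its quotients, among them the duals of right ideals, are
injective again; a finite dimensional module with injective dual is projective.
-/

namespace NodalAlg

section Opposite

/-! ### The Jacobson radical of the opposite ring -/

theorem isUnit_one_add_of_mem_jacobson {R : Type*} [Ring R] {x : R}
    (hx : x ∈ Ring.jacobson R) : IsUnit (1 + x) := by
  have left_inv : ∀ y ∈ Ring.jacobson R, ∃ z, z * (1 + y) = 1 := by
    intro y hy
    rw [← Ideal.jacobson_bot] at hy
    obtain ⟨z, hz⟩ := Ideal.mem_jacobson_iff.1 hy 1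
    refine ⟨z, ?_⟩
    rw [mul_one, Ideal.mem_bot, sub_eq_zero] at hz
    rw [mul_add, mul_one, add_comm, hz]
  obtain ⟨z, hz⟩ := left_inv x hx
  -- The left inverse `z = 1 - z * x` again has a left inverse, which must be `1 + x`.
  have hzx : z = 1 + -(z * x) := by
    rw [← hz]; noncomm_ring
  obtain ⟨w, hw⟩ := left_inv _ (neg_mem (Ideal.mul_mem_left _ z hx))
  rw [← hzx] at hw
  have hwx : w = 1 + x := by
    calc w = w * (z * (1 + x)) := by rw [hz, mul_one]
      _ = 1 + x := by rw [← mul_assoc, hw, one_mul]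
  exact ⟨⟨1 + x, z, hwx ▸ hw, hz⟩, rfl⟩

theorem op_mem_jacobson {R : Type*} [Ring R] {x : R} (hx : x ∈ Ring.jacobson R) :
    MulOpposite.op x ∈ Ring.jacobson Rᵐᵒᵖ := by
  rw [← Ideal.jacobson_bot, Ideal.mem_jacobson_iff]
  intro y
  obtain ⟨u, hu⟩ := isUnit_one_add_of_mem_jacobson (Ideal.mul_mem_right y.unop _ hx)
  refine ⟨MulOpposite.op (↑u⁻¹ : R), ?_⟩
  rw [Ideal.mem_bot, sub_eq_zero]
  apply MulOpposite.unop_injective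
  simp only [MulOpposite.unop_add, MulOpposite.unop_mul, MulOpposite.unop_op, MulOpposite.unop_one]
  calc x * (y.unop * ↑u⁻¹) + ↑u⁻¹ = (1 + x * y.unop) * ↑u⁻¹ := by noncomm_ring
    _ = 1 := by rw [← hu, Units.mul_inv]

theorem op_mem_jacobson_iff {R : Type*} [Ring R] {x : R} :
    MulOpposite.op x ∈ Ring.jacobson Rᵐᵒᵖ ↔ x ∈ Ring.jacobson R := by
  refine ⟨fun h ↦ ?_, op_mem_jacobson⟩
  have : RingHomSurjective (RingEquiv.opOp R).symm.toRingHom :=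
    ⟨(RingEquiv.opOp R).symm.surjective⟩
  exact Ring.le_comap_jacobson (RingEquiv.opOp R).symm.toRingHom (op_mem_jacobson h)

end Opposite

section Dual

/-! ### Heredity of the opposite algebra -/

variable (k : Type*) [Field k] (H : Type*) [Ring H] [Algebra k H]

/-- The dual of a right `H`-module `N`, as a left `H`-module: `(h • φ) n = φ (n · h)`. -/
def RightDual (N : Type*) [AddCommGroup N] [Module k N] : Type _ := N →ₗ[k] k

variable (N : Type*) [AddCommGroup N] [Module k N] [Module Hᵐᵒᵖ N] [IsScalarTower k Hᵐᵒᵖ N]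

noncomputable instance : AddCommGroup (RightDual k N) := inferInstanceAs (AddCommGroup (N →ₗ[k] k))

noncomputable instance : Module H (RightDual k N) where
  smul h φ := LinearMap.comp (show N →ₗ[k] k from φ) (Algebra.lsmul k k N (MulOpposite.op h))
  one_smul φ := LinearMap.ext fun n ↦ congrArg (show N →ₗ[k] k from φ) (one_smul Hᵐᵒᵖ n)
  mul_smul a b φ := LinearMap.ext fun n ↦
    congrArg (show N →ₗ[k] k from φ) (mul_smul (MulOpposite.op b) (MulOpposite.op a) n)
  smul_zero _ := LinearMap.zero_comp _
  smul_add _ _ _ := LinearMap.add_comp _ _ _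
  add_smul a b φ := LinearMap.ext fun n ↦
    (congrArg (show N →ₗ[k] k from φ) (add_smul (MulOpposite.op a) (MulOpposite.op b) n)).trans
      (map_add _ _ _)
  zero_smul φ := LinearMap.ext fun n ↦
    (congrArg (show N →ₗ[k] k from φ) (zero_smul Hᵐᵒᵖ n)).trans (map_zero _)

variable {k H N}

/-- A functional on `N`, as an element of the left module `RightDual k N`. -/
def RightDual.of (φ : N →ₗ[k] k) : RightDual k N := φ

/-- The functional underlying an element of `RightDual k N`. -/
def RightDual.toLin (φ : RightDual k N) : N →ₗ[k] k := φ

theorem RightDual.smul_apply (h : H) (φ : RightDual k N) (n : N) :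
    (h • φ).toLin n = φ.toLin (MulOpposite.op h • n) := rfl

theorem RightDual.ext {φ ψ : RightDual k N} (h : ∀ n, φ.toLin n = ψ.toLin n) : φ = ψ :=
  LinearMap.ext h

/-- The transpose of a homomorphism of right modules. -/
noncomputable def RightDual.map {M : Type*} [AddCommGroup M] [Module k M] [Module Hᵐᵒᵖ M]
    [IsScalarTower k Hᵐᵒᵖ M] (f : M →ₗ[Hᵐᵒᵖ] N) : RightDual k N →ₗ[H] RightDual k M where
  toFun φ := .of (φ.toLin ∘ₗ f.restrictScalars k)
  map_add' _ _ := rfl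
  map_smul' h φ := RightDual.ext fun m ↦
    congrArg φ.toLin (f.map_smul (MulOpposite.op h) m).symm

theorem RightDual.map_apply {M : Type*} [AddCommGroup M] [Module k M] [Module Hᵐᵒᵖ M]
    [IsScalarTower k Hᵐᵒᵖ M] (f : M →ₗ[Hᵐᵒᵖ] N) (φ : RightDual k N) (m : M) :
    (RightDual.map f φ).toLin m = φ.toLin (f m) := rfl

/-- Extending a functional on a left ideal to the whole algebra shows that the dual of the
regular right module is injective. -/
theorem baer_rightDual_self : Module.Baer H (RightDual k Hᵐᵒᵖ) := by
  intro I g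
  -- A homomorphism `g` into the dual is determined by the functional `x ↦ g x 1`.
  let φ : I →ₗ[k] k :=
    { toFun x := (g x).toLin 1
      map_add' x y := by rw [map_add]; rfl
      map_smul' c x := by
        have hx : c • x = (algebraMap k H c) • x := by
          ext; simp [Algebra.smul_def]
        rw [hx, map_smul, RightDual.smul_apply, ← MulOpposite.algebraMap_apply, algebraMap_smul,
          map_smul, RingHom.id_apply] }
  obtain ⟨ψ, hψ⟩ := LinearMap.exists_extend (p := I.restrictScalars k) φ
  have hψ' : ∀ x : I, ψ x = (g x).toLin 1 := fun x ↦ LinearMap.congr_fun hψ x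
  let Ψ : RightDual k Hᵐᵒᵖ := .of (ψ ∘ₗ (MulOpposite.opLinearEquiv k).symm.toLinearMap)
  refine ⟨LinearMap.toSpanSingleton H _ Ψ, fun x hx ↦ RightDual.ext fun y ↦ ?_⟩
  have key : (g (y.unop • ⟨x, hx⟩)).toLin 1 = (g ⟨x, hx⟩).toLin y := by
    rw [map_smul, RightDual.smul_apply, MulOpposite.op_unop, smul_eq_mul, mul_one]
  rw [← key, ← hψ', LinearMap.toSpanSingleton_apply, RightDual.smul_apply]
  rfl

/-- Over a hereditary ring quotients of injective modules are injective: a homomorphism from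
a left ideal lifts along the quotient map because left ideals are projective. -/
theorem IsHereditary.baer_of_surjective {R : Type*} [Ring R] (hR : IsHereditary R)
    {E Q : Type*} [AddCommGroup E] [Module R E] [AddCommGroup Q] [Module R Q]
    (hE : Module.Baer R E) (f : E →ₗ[R] Q) (hf : Function.Surjective f) : Module.Baer R Q := by
  intro I g
  have := hR I
  obtain ⟨l, hl⟩ := Module.projective_lifting_property f g hf
  obtain ⟨l', hl'⟩ := hE I l
  refine ⟨f ∘ₗ l', fun x hx ↦ ?_⟩
  rw [LinearMap.comp_apply, hl' x hx, ← hl, LinearMap.comp_apply]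

/-- A finite dimensional right module is projective as soon as its dual is an injective left
module: dualizing a surjection from a free module gives a split injection. -/
theorem projective_of_baer_rightDual [Module.Finite k H] [Module.Finite k N]
    (h : Module.Baer H (RightDual k N)) : Module.Projective Hᵐᵒᵖ N := by
  have : Module.Finite Hᵐᵒᵖ N := Module.Finite.of_restrictScalars_finite k _ _
  obtain ⟨n, π, hπ⟩ := Module.Finite.exists_fin' Hᵐᵒᵖ N
  have inj : Function.Injective (RightDual.map (k := k) π) := by
    intro φ ψ hφψ
    refine RightDual.ext fun x ↦ ?_
    obtain ⟨y, rfl⟩ := hπ x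
    rw [← RightDual.map_apply, hφψ, RightDual.map_apply]
  obtain ⟨ρ, hρ⟩ := h.extension_property _ inj LinearMap.id
  have hρ' : ∀ φ : RightDual k N, ρ (RightDual.map π φ) = φ := fun φ ↦ LinearMap.congr_fun hρ φ
  have : Module.Finite k Hᵐᵒᵖ := Module.Finite.equiv (MulOpposite.opLinearEquiv k)
  -- The transpose of the retraction `ρ` is a section of `π`, as the free module is reflexive.
  let ρk : Module.Dual k (Fin n → Hᵐᵒᵖ) →ₗ[k] Module.Dual k N :=
    { toFun φ := (ρ (.of φ)).toLin
      map_add' φ ψ := congrArg RightDual.toLin (ρ.map_add (.of φ) (.of ψ))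
      map_smul' c φ := by
        have h1 : RightDual.of (c • φ) = algebraMap k H c • RightDual.of φ :=
          RightDual.ext fun x ↦ by
            rw [RightDual.smul_apply, ← MulOpposite.algebraMap_apply, algebraMap_smul, map_smul]
            rfl
        rw [h1, map_smul]
        refine LinearMap.ext fun x ↦ ?_
        rw [RightDual.smul_apply, ← MulOpposite.algebraMap_apply, algebraMap_smul, map_smul]
        rfl }
  let s : N → (Fin n → Hᵐᵒᵖ) := fun x ↦
    (Module.evalEquiv k (Fin n → Hᵐᵒᵖ)).symm (Module.Dual.eval k N x ∘ₗ ρk)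
  have hs : ∀ x (φ : Module.Dual k (Fin n → Hᵐᵒᵖ)), φ (s x) = (ρ (.of φ)).toLin x := fun x φ ↦ by
    exact LinearMap.congr_fun ((Module.evalEquiv k (Fin n → Hᵐᵒᵖ)).apply_symm_apply
      (Module.Dual.eval k N x ∘ₗ ρk)) φ
  have sep : ∀ a b : Fin n → Hᵐᵒᵖ, (∀ φ : Module.Dual k (Fin n → Hᵐᵒᵖ), φ a = φ b) → a = b :=
    fun a b hab ↦ (Module.evalEquiv k (Fin n → Hᵐᵒᵖ)).injective (LinearMap.ext hab)
  refine Module.Projective.of_split (P := N) (M := Fin n → Hᵐᵒᵖ)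
    { toFun := s
      map_add' := fun x y ↦ sep _ _ fun φ ↦ by rw [map_add, hs, hs, hs, map_add]
      map_smul' := fun a x ↦ sep _ _ fun φ ↦ ?_ } π (LinearMap.ext fun x ↦ ?_)
  · have h1 := RightDual.smul_apply a.unop (RightDual.of φ) (s x)
    rw [MulOpposite.op_unop] at h1
    rw [hs, RingHom.id_apply]
    refine Eq.trans ?_ h1
    refine Eq.trans ?_ (hs x _).symm
    change (ρ (.of φ)).toLin (a • x) = (ρ (a.unop • RightDual.of φ)).toLin x
    rw [ρ.map_smul, RightDual.smul_apply, MulOpposite.op_unop]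
  · refine sub_eq_zero.1 ((Module.forall_dual_apply_eq_zero_iff k _).1 fun ψ ↦ ?_)
    have h1 := hs x (ψ ∘ₗ π.restrictScalars k)
    have h2 := congrArg (fun φ ↦ RightDual.toLin φ x) (hρ' (.of ψ))
    rw [map_sub, sub_eq_zero]
    exact h1.trans h2

/-- Left hereditary finite dimensional algebras are right hereditary: the dual of a right ideal is
a quotient of the injective dual of the regular right module. -/
theorem IsHereditary.op [Module.Finite k H] (hH : IsHereditary H) : IsHereditary Hᵐᵒᵖ := by
  intro I
  have : Module.Finite k Hᵐᵒᵖ := Module.Finite.equiv (MulOpposite.opLinearEquiv k)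
  have : Module.Finite k I := inferInstanceAs (Module.Finite k (I.restrictScalars k))
  refine projective_of_baer_rightDual (k := k) (H := H)
    (hH.baer_of_surjective baer_rightDual_self (RightDual.map I.subtype) fun φ ↦ ?_)
  obtain ⟨ψ, hψ⟩ := LinearMap.exists_extend (p := I.restrictScalars k) φ.toLin
  exact ⟨.of ψ, RightDual.ext fun x ↦ LinearMap.congr_fun hψ x⟩

end Dual

section TensorAPI

/-! ### The universal property of the tensor products -/

variable {A : Type*} {H : Type*} [Ring A] [Ring H] (ι : A →+* H)

section Left

variable (U : Type*) [AddCommGroup U] [Module A U]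

/-- The action of `A` on `H ⊗_A U` which defines `leftLength`. -/
@[reducible] noncomputable def leftTensorModule : Module A (LeftTensor ι U) :=
  Module.compHom (LeftTensor ι U) ι

variable {U}

/-- The element `h ⊗ u` of `H ⊗_A U`. -/
noncomputable def leftMk (h : H) (u : U) : LeftTensor ι U :=
  (leftRelations ι U).mkQ (h ⊗ₜ[ℤ] u)

/-- The universal balanced map `(h, u) ↦ h ⊗ u`. -/
noncomputable def leftMkHom : H →+ U →+ LeftTensor ι U :=
  AddMonoidHom.mk' (fun h ↦ AddMonoidHom.mk' (leftMk ι h) fun u u' ↦ by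
      simp only [leftMk, TensorProduct.tmul_add, map_add])
    fun h h' ↦ AddMonoidHom.ext fun u ↦ by
      change leftMk ι (h + h') u = leftMk ι h u + leftMk ι h' u
      simp only [leftMk, TensorProduct.add_tmul, map_add]

theorem leftMk_mul (h : H) (a : A) (u : U) : leftMk ι (h * ι a) u = leftMk ι h (a • u) :=
  (Submodule.Quotient.eq _).2 (AddSubgroup.subset_closure ⟨h, a, u, rfl⟩)

theorem smul_leftMk (a : A) (h : H) (u : U) :
    letI := leftTensorModule ι U
    a • leftMk ι h u = leftMk ι (ι a * h) u := rfl

theorem leftTensor_induction {p : LeftTensor ι U → Prop} (h0 : p 0)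
    (hmk : ∀ h u, p (leftMk ι h u)) (hadd : ∀ x y, p x → p y → p (x + y)) (z) : p z := by
  obtain ⟨z, rfl⟩ := Submodule.mkQ_surjective _ z
  induction z using TensorProduct.induction_on with
  | zero => rwa [map_zero]
  | tmul h u => exact hmk h u
  | add x y hx hy => rw [map_add]; exact hadd _ _ hx hy

/-- Balanced biadditive maps on `H × U` induce additive maps on `H ⊗_A U`. -/
noncomputable def leftLift {B : Type*} [AddCommGroup B] (F : H →+ U →+ B)
    (hF : ∀ h a u, F (h * ι a) u = F h (a • u)) : LeftTensor ι U →+ B :=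
  QuotientAddGroup.lift (leftRelations ι U).toAddSubgroup
    (TensorProduct.liftAddHom F fun n h u ↦ by rw [map_zsmul, map_zsmul]; rfl) (by
      refine (AddSubgroup.closure_le _).2 ?_
      rintro _ ⟨h, a, u, rfl⟩
      exact (map_sub _ _ _).trans (sub_eq_zero.2 (hF h a u)))

end Left

section Right

variable (U : Type*) [AddCommGroup U] [Module Aᵐᵒᵖ U]

/-- The action of `A` on `U ⊗_A H` which defines `rightLength`. -/
@[reducible] noncomputable def rightTensorModule : Module Aᵐᵒᵖ (RightTensor ι U) :=
  letI := rightModule H U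
  Module.compHom (RightTensor ι U) (RingHom.op ι)

variable {U}

/-- The element `u ⊗ h` of `U ⊗_A H`. -/
noncomputable def rightMk (u : U) (h : H) : RightTensor ι U :=
  letI := rightModule H U
  (rightRelations ι U).mkQ (u ⊗ₜ[ℤ] h)

/-- The universal balanced map `(u, h) ↦ u ⊗ h`. -/
noncomputable def rightMkHom : U →+ H →+ RightTensor ι U :=
  letI := rightModule H U
  AddMonoidHom.mk' (fun u ↦ AddMonoidHom.mk' (rightMk ι u) fun h h' ↦ by
      simp only [rightMk, TensorProduct.tmul_add, map_add])
    fun u u' ↦ AddMonoidHom.ext fun h ↦ by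
      change rightMk ι (u + u') h = rightMk ι u h + rightMk ι u' h
      simp only [rightMk, TensorProduct.add_tmul, map_add]

theorem rightMk_mul (u : U) (a : A) (h : H) :
    rightMk ι u (ι a * h) = rightMk ι (MulOpposite.op a • u) h :=
  let := rightModule H U
  Eq.symm <| (Submodule.Quotient.eq _).2 (AddSubgroup.subset_closure ⟨u, a, h, rfl⟩)

theorem smul_rightMk (a : Aᵐᵒᵖ) (u : U) (h : H) :
    letI := rightTensorModule ι U
    a • rightMk ι u h = rightMk ι u (h * ι a.unop) := rfl

theorem rightTensor_induction {p : RightTensor ι U → Prop} (h0 : p 0)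
    (hmk : ∀ u h, p (rightMk ι u h)) (hadd : ∀ x y, p x → p y → p (x + y)) (z) : p z := by
  let := rightModule H U
  obtain ⟨z, rfl⟩ := Submodule.mkQ_surjective _ z
  induction z using TensorProduct.induction_on with
  | zero => rwa [map_zero]
  | tmul u h => exact hmk u h
  | add x y hx hy => rw [map_add]; exact hadd _ _ hx hy

/-- Balanced biadditive maps on `U × H` induce additive maps on `U ⊗_A H`. -/
noncomputable def rightLift {B : Type*} [AddCommGroup B] (F : U →+ H →+ B)
    (hF : ∀ u a h, F (MulOpposite.op a • u) h = F u (ι a * h)) : RightTensor ι U →+ B :=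
  letI := rightModule H U
  QuotientAddGroup.lift (rightRelations ι U).toAddSubgroup
    (TensorProduct.liftAddHom F fun n u h ↦ by rw [map_zsmul, map_zsmul]; rfl) (by
      refine (AddSubgroup.closure_le _).2 ?_
      rintro _ ⟨u, a, h, rfl⟩
      exact (map_sub _ _ _).trans (sub_eq_zero.2 (hF u a h)))

end Right

end TensorAPI

section Swap

/-! ### Induced modules over opposite rings -/

/-- The rings may differ: it suffices that every scalar acting on the image of `f` comes from
a scalar on `M`. -/
theorem length_le_of_injective {R R' M N : Type*} [Ring R] [Ring R'] [AddCommGroup M] [Module R M]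
    [AddCommGroup N] [Module R' N] (f : M →+ N) (hf : Function.Injective f)
    (hsmul : ∀ b : R', ∃ a : R, ∀ m, b • f m = f (a • m)) :
    Module.length R M ≤ Module.length R' N := by
  rw [← WithBot.coe_le_coe, Module.coe_length, Module.coe_length]
  let F : Submodule R M → Submodule R' N := fun P ↦
    { P.toAddSubgroup.map f with
      smul_mem' := by
        rintro b _ ⟨m, hm, rfl⟩
        obtain ⟨a, ha⟩ := hsmul b
        exact ⟨a • m, P.smul_mem a hm, (ha m).symm⟩ }
  have hF : ∀ P Q, F P ≤ F Q ↔ P ≤ Q := fun P Q ↦ Set.image_subset_image_iff hf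
  exact Order.krullDim_le_of_strictMono F fun P Q h ↦
    lt_of_le_not_ge ((hF _ _).2 h.le) (mt (hF _ _).1 h.not_ge)

variable {A : Type*} {H : Type*} [Ring A] [Ring H] (ι : A →+* H)

/-- A right `A`-module is a left `Aᵐᵒᵖ`-module, and `h ⊗ u ↦ u ⊗ h` identifies the two induced
modules. -/
theorem leftLength_op_le (U : Type*) [AddCommGroup U] [Module Aᵐᵒᵖ U] :
    leftLength (RingHom.op ι) U ≤ rightLength ι U := by
  let := leftTensorModule (RingHom.op ι) U
  let := rightTensorModule ι U
  let f : LeftTensor (RingHom.op ι) U →+ RightTensor ι U :=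
    leftLift (RingHom.op ι)
      ((rightMkHom ι).flip.comp (MulOpposite.opAddEquiv (α := H)).symm.toAddMonoidHom)
      fun h a u ↦ rightMk_mul ι u a.unop h.unop
  let g : RightTensor ι U →+ LeftTensor (RingHom.op ι) U :=
    rightLift ι ((leftMkHom (RingHom.op ι)).comp
        (MulOpposite.opAddEquiv (α := H)).toAddMonoidHom).flip
      fun u a h ↦ (leftMk_mul (RingHom.op ι) (.op h) (.op a) u).symm
  refine length_le_of_injective f (Function.LeftInverse.injective (g := g) fun z ↦ ?_)
    fun b ↦ ⟨b, fun z ↦ ?_⟩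
  · induction z using leftTensor_induction with
    | h0 => simp
    | hmk h u => rfl
    | hadd x y hx hy => rw [map_add, map_add, hx, hy]
  · induction z using leftTensor_induction with
    | h0 => simp
    | hmk h u => rfl
    | hadd x y hx hy => rw [map_add, smul_add, hx, hy, smul_add, map_add]

/-- A left `A`-module, as a right module over `Aᵐᵒᵖ`. -/
@[reducible] def doubleOpModule (A : Type*) [Ring A] (U : Type*) [AddCommGroup U] [Module A U] :
    Module Aᵐᵒᵖᵐᵒᵖ U :=
  Module.compHom U (RingEquiv.opOp A).symm.toRingHom

theorem isSimpleModule_doubleOp (U : Type*) [AddCommGroup U] [Module A U] [IsSimpleModule A U] :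
    letI := doubleOpModule A U
    IsSimpleModule Aᵐᵒᵖᵐᵒᵖ U := by
  let := doubleOpModule A U
  refine isSimpleModule_iff_toSpanSingleton_surjective.2
    ⟨IsSimpleModule.nontrivial A U, fun m hm u ↦ ?_⟩
  obtain ⟨a, ha⟩ := IsSimpleModule.toSpanSingleton_surjective A hm u
  exact ⟨.op (.op a), ha⟩

/-- The map `h ⊗ u ↦ u ⊗ h` identifies the two induced modules. -/
theorem leftLength_le_rightLength_op (U : Type*) [AddCommGroup U] [Module A U] :
    letI := doubleOpModule A U
    leftLength ι U ≤ rightLength (RingHom.op ι) U := by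
  let := doubleOpModule A U
  let := leftTensorModule ι U
  let := rightTensorModule (RingHom.op ι) U
  let f : LeftTensor ι U →+ RightTensor (RingHom.op ι) U :=
    leftLift ι
      ((rightMkHom (RingHom.op ι)).flip.comp (MulOpposite.opAddEquiv (α := H)).toAddMonoidHom)
      fun h a u ↦ rightMk_mul (RingHom.op ι) u (.op a) (.op h)
  let g : RightTensor (RingHom.op ι) U →+ LeftTensor ι U :=
    rightLift (RingHom.op ι) ((leftMkHom ι).comp
        (MulOpposite.opAddEquiv (α := H)).symm.toAddMonoidHom).flip
      fun u a h ↦ (leftMk_mul ι h.unop a.unop u).symm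
  refine length_le_of_injective f (Function.LeftInverse.injective (g := g) fun z ↦ ?_)
    fun b ↦ ⟨b.unop.unop, fun z ↦ ?_⟩
  · induction z using leftTensor_induction with
    | h0 => simp
    | hmk h u => rfl
    | hadd x y hx hy => rw [map_add, map_add, hx, hy]
  · induction z using leftTensor_induction with
    | h0 => simp
    | hmk h u => rfl
    | hadd x y hx hy => rw [map_add, smul_add, hx, hy, smul_add, map_add]

end Swap

section TraceForm

/-! ### The trace form of a semisimple algebra -/

/-- The sum of the matrix traces of the simple factors is a symmetric, nondegenerate form. -/
theorem exists_symmetrizing_form (k : Type*) [Field k] [IsAlgClosed k] (S : Type*) [Ring S]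
    [Algebra k S] [Module.Finite k S] [IsSemisimpleRing S] :
    ∃ t : S →ₗ[k] k, (∀ x y, t (x * y) = t (y * x)) ∧
      ∀ φ : S →ₗ[k] k, ∃ s, ∀ y, φ y = t (y * s) := by
  obtain ⟨n, d, -, ⟨e⟩⟩ := IsSemisimpleRing.exists_algEquiv_pi_matrix_of_isAlgClosed k S
  let t : S →ₗ[k] k := ∑ i, Matrix.traceLinearMap (Fin (d i)) k k ∘ₗ LinearMap.proj i ∘ₗ
    e.toLinearMap
  have ht : ∀ x, t x = ∑ i, (e x i).trace := fun x ↦ by simp [t]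
  have nondeg : ∀ s, (∀ y, t (y * s) = 0) → s = 0 := by
    intro s hs
    refine e.injective (funext fun i ↦ ?_)
    rw [map_zero, Pi.zero_apply, Matrix.ext_iff_trace_mul_left]
    intro x
    have h := hs (e.symm (Pi.single i x))
    rw [ht, Finset.sum_eq_single i] at h
    · simpa using h
    · intro j _ hj
      simp [hj]
    · simp
  refine ⟨t, fun x y ↦ ?_, fun φ ↦ ?_⟩
  · simp only [ht, map_mul, Pi.mul_apply]
    exact Finset.sum_congr rfl fun i _ ↦ Matrix.trace_mul_comm _ _
  · let B : S →ₗ[k] Module.Dual k S := (LinearMap.mul k S).flip.compr₂ t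
    have hB : Function.Injective B := (injective_iff_map_eq_zero B).2 fun s hs ↦
      nondeg s fun y ↦ LinearMap.congr_fun hs y
    obtain ⟨s, hs⟩ := (LinearMap.injective_iff_surjective_of_finrank_eq_finrank
      Subspace.dual_finrank_eq.symm).1 hB φ
    exact ⟨s, fun y ↦ (LinearMap.congr_fun hs y).symm⟩

end TraceForm

section Idempotent

/-! ### Idempotents and cyclic modules over a semisimple ring -/

variable {A R W : Type*} [Ring A] [Ring R] [IsSemisimpleRing R] [AddCommGroup W] [Module Aᵐᵒᵖ W]

/-- Semisimple rings are von Neumann regular. -/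
theorem exists_mul_mul_eq_self (x : R) : ∃ b, x * b * x = x := by
  obtain ⟨e, he, hx⟩ := IsSemisimpleRing.ideal_eq_span_idempotent (Ideal.span {x})
  obtain ⟨b, hb⟩ := Ideal.mem_span_singleton'.1 (hx ▸ Ideal.mem_span_singleton_self e)
  obtain ⟨c, hc⟩ := Ideal.mem_span_singleton'.1 (hx ▸ Ideal.mem_span_singleton_self x)
  exact ⟨b, by rw [mul_assoc, hb, ← hc, mul_assoc, he.eq]⟩

/-- A cyclic right `A`-module `w A` on which `A` acts through the semisimple ring `R` is
isomorphic to `e R` for an idempotent `e`, with `w` corresponding to `e`. -/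
theorem exists_idempotent_annihilator (π : A →+* R) (hπ : Function.Surjective π) (w : W)
    (hw : ∀ a, π a = 0 → MulOpposite.op a • w = 0) :
    ∃ e : R, IsIdempotentElem e ∧ ∀ a, MulOpposite.op a • w = 0 ↔ e * π a = 0 := by
  have hπ' : Function.Surjective (RingHom.op π) := fun r ↦
    (hπ r.unop).imp' MulOpposite.op fun a ha ↦ MulOpposite.unop_injective ha
  let I : Ideal Aᵐᵒᵖ := LinearMap.ker (LinearMap.toSpanSingleton Aᵐᵒᵖ W w)
  have hI : ∀ a, MulOpposite.op a • w = 0 ↔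
      MulOpposite.op (π a) ∈ Ideal.map (RingHom.op π) I := by
    intro a
    rw [Ideal.mem_map_iff_of_surjective _ hπ']
    refine ⟨fun h ↦ ⟨.op a, h, rfl⟩, ?_⟩
    rintro ⟨b, hb, hab⟩
    have hb' : b • w = 0 := hb
    have := hw (b.unop - a) (by
      rw [map_sub, sub_eq_zero]; exact congrArg MulOpposite.unop hab)
    rwa [MulOpposite.op_sub, MulOpposite.op_unop, sub_smul, hb', zero_sub, neg_eq_zero] at this
  obtain ⟨f, hf, hIf⟩ := IsSemisimpleRing.ideal_eq_span_idempotent (Ideal.map (RingHom.op π) I)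
  have hf' : IsIdempotentElem f.unop := congrArg MulOpposite.unop hf.eq
  refine ⟨1 - f.unop, hf'.one_sub, fun a ↦ ?_⟩
  rw [hI, hIf, Ideal.mem_span_singleton', sub_mul, one_mul, sub_eq_zero]
  constructor
  · rintro ⟨c, hc⟩
    have : π a = f.unop * c.unop := (congrArg MulOpposite.unop hc).symm
    rw [this, ← mul_assoc, hf'.eq]
  · exact fun h ↦ ⟨.op (π a), MulOpposite.unop_injective h.symm⟩

/-- In a semisimple ring, if the right ideal `e R` is simple then so is the left ideal `R e`. -/
theorem exists_mul_eq_of_mul_idempotent {e : R}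
    (hsimple : ∀ r, e * r ≠ 0 → ∃ s, e * r * s = e) {x : R} (hxe : x * e = x) (hx : x ≠ 0) :
    ∃ y, y * x = e := by
  obtain ⟨b, hb⟩ := exists_mul_mul_eq_self x
  -- The element `u = e * b * x` is a nonzero idempotent of `e R e`, hence equal to `e`.
  have hu : (e * b * x) * (e * b * x) = e * b * x := by
    calc (e * b * x) * (e * b * x) = e * b * ((x * e) * b * x) := by noncomm_ring
      _ = e * b * x := by rw [hxe, hb]
  have hu0 : e * (b * x) ≠ 0 := fun h ↦ hx <| by
    calc x = (x * e) * b * x := by rw [hxe, hb]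
      _ = x * (e * (b * x)) := by noncomm_ring
      _ = 0 := by rw [h, mul_zero]
  obtain ⟨c, hc⟩ := hsimple _ hu0
  rw [← mul_assoc] at hc
  refine ⟨e * b, ?_⟩
  calc e * b * x = e * b * x * e := by rw [mul_assoc (e * b), hxe]
    _ = (e * b * x) * (e * b * x) * c := by rw [mul_assoc (e * b * x), hc]
    _ = e := by rw [hu, hc]

end Idempotent

section Pairing

/-! ### Comparison of lengths by a dual pairing -/

/-- The form `t` pairs `M`, which maps onto at least `S e`, with `N ⊆ e S`; taking orthogonal
complements embeds the submodule lattice of `N` into the opposite of that of `M`. -/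
theorem length_le_of_symmetrizing_form {k A S M N : Type*} [Field k] [Ring A] [Ring S]
    [Algebra k S] [AddCommGroup M] [Module A M] [AddCommGroup N] [Module Aᵐᵒᵖ N]
    (t : S →ₗ[k] k) (t_comm : ∀ x y, t (x * y) = t (y * x))
    (t_dual : ∀ φ : S →ₗ[k] k, ∃ s, ∀ y, φ y = t (y * s))
    (σ : A →+* S) (hσ : ∀ c, ∃ a, σ a = algebraMap k S c) (e : S)
    (f : M →+ S) (hf : ∀ a m, f (a • m) = σ a * f m) (hfe : ∀ s, ∃ m, f m = s * e)
    (g : N →+ S) (hg : ∀ a n, g (MulOpposite.op a • n) = g n * σ a)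
    (g_inj : Function.Injective g) (hge : ∀ n, e * g n = g n) :
    Module.length Aᵐᵒᵖ N ≤ Module.length A M := by
  rw [← WithBot.coe_le_coe, Module.coe_length, Module.coe_length,
    ← Order.krullDim_orderDual (α := Submodule A M)]
  let F : Submodule Aᵐᵒᵖ N → Submodule A M := fun P ↦
    { carrier := {m | ∀ n ∈ P, t (g n * f m) = 0}
      zero_mem' := fun n _ ↦ by simp
      add_mem' := fun {x y} hx hy n hn ↦ by
        rw [map_add, mul_add, map_add, hx n hn, hy n hn, add_zero]
      smul_mem' := fun a m hm n hn ↦ by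
        rw [hf, ← mul_assoc, ← hg]
        exact hm _ (P.smul_mem _ hn) }
  refine Order.krullDim_le_of_strictMono (fun P ↦ OrderDual.toDual (F P)) fun P Q hPQ ↦ ?_
  refine OrderDual.toDual_lt_toDual.2 (lt_of_le_not_ge (fun m hm n hn ↦ hm n (hPQ.le hn)) ?_)
  obtain ⟨q, hqQ, hqP⟩ := SetLike.exists_of_lt hPQ
  let gP : Submodule k S :=
    { P.toAddSubgroup.map g with
      smul_mem' := by
        rintro c _ ⟨n, hn, rfl⟩
        obtain ⟨a, ha⟩ := hσ c
        refine ⟨MulOpposite.op a • n, P.smul_mem _ hn, ?_⟩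
        rw [hg, ha, Algebra.smul_def, Algebra.commutes] }
  have hq : g q ∉ gP := by
    rintro ⟨n, hn, hnq⟩
    exact hqP (g_inj hnq ▸ hn)
  obtain ⟨φ, hφq, hφP⟩ := Submodule.exists_le_ker_of_notMem hq
  obtain ⟨s, hs⟩ := t_dual φ
  obtain ⟨m, hm⟩ := hfe s
  have key : ∀ n, t (g n * f m) = φ (g n) := fun n ↦ by
    rw [hs, hm, ← mul_assoc, t_comm, ← mul_assoc, hge]
  intro hle
  refine hφq ?_
  rw [← key]
  exact hle (show m ∈ F P from fun n hn ↦ (key n).trans (hφP ⟨n, hn, rfl⟩)) q hqQ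

end Pairing

section Comparison

/-! ### Left and right lengths for embeddings with a common radical -/

variable {k : Type u} {A : Type v} {H : Type w}
variable [Field k] [Ring A] [Algebra k A] [Ring H] [Algebra k H]

theorem op_smul_eq_zero_of_mem_jacobson {W : Type*} [AddCommGroup W] [Module Aᵐᵒᵖ W]
    [IsSimpleModule Aᵐᵒᵖ W] {a : A} (ha : a ∈ Ring.jacobson A) (w : W) :
    MulOpposite.op a • w = 0 :=
  Module.mem_annihilator.1
    (IsSemisimpleModule.jacobson_le_annihilator Aᵐᵒᵖ W (op_mem_jacobson ha)) w

/-- If the right ideal `e R` of `R = A / rad A` is simple, then the left ideal `R e` is simple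
over `A`. -/
theorem isSimpleModule_span_idempotent {e : A ⧸ Ring.jacobson A}
    [IsSemisimpleRing (A ⧸ Ring.jacobson A)] (he : IsIdempotentElem e) (he0 : e ≠ 0)
    (hsimple : ∀ r, e * r ≠ 0 → ∃ s, e * r * s = e) :
    IsSimpleModule A (Submodule.span A {e}) := by
  have hsmul : ∀ (a : A) (r : A ⧸ Ring.jacobson A), a • r = Ideal.Quotient.mk _ a * r := by
    intro a r
    obtain ⟨r, rfl⟩ := Ideal.Quotient.mk_surjective r
    rfl
  refine isSimpleModule_iff_toSpanSingleton_surjective.2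
    ⟨⟨⟨⟨e, Submodule.mem_span_singleton_self e⟩, 0, fun h ↦ he0 (congrArg Subtype.val h)⟩⟩, ?_⟩
  rintro ⟨x, hx⟩ hx0 ⟨z, hz⟩
  obtain ⟨a, rfl⟩ := Submodule.mem_span_singleton.1 hx
  obtain ⟨b, rfl⟩ := Submodule.mem_span_singleton.1 hz
  obtain ⟨y, hy⟩ := exists_mul_eq_of_mul_idempotent hsimple (x := a • e)
    (by rw [hsmul, mul_assoc, he.eq]) fun h ↦ hx0 (Subtype.ext h)
  obtain ⟨y, rfl⟩ := Ideal.Quotient.mk_surjective y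
  refine ⟨b * y, Subtype.ext ?_⟩
  change (b * y) • a • e = b • e
  rw [mul_smul, hsmul y, hy]

/-- The simple right module `W` is `e R` for an idempotent `e` of `R = A / rad A`, and `U = R e`
is the simple left module with the required property. With `S = H / rad H`, the product maps
`W ⊗_A H` isomorphically onto `e S` and `H ⊗_A U` onto `S e`, and the trace form of the
semisimple algebra `S` puts these two in duality. -/
theorem IsRadicalEmbedding.exists_rightLength_le [IsAlgClosed k] {ι : A →ₐ[k] H}
    (h : IsRadicalEmbedding ι) (W : Type v) [AddCommGroup W] [Module Aᵐᵒᵖ W]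
    [IsSimpleModule Aᵐᵒᵖ W] :
    ∃ (U : Type v) (_ : AddCommGroup U) (_ : Module A U), IsSimpleModule A U ∧
      rightLength (ι : A →+* H) W ≤ leftLength (ι : A →+* H) U := by
  have := h.finite
  have : Module.Finite k A := Module.Finite.of_injective ι.toLinearMap h.injective
  have : IsArtinianRing A := IsArtinianRing.of_finite k A
  have : IsArtinianRing H := IsArtinianRing.of_finite k H
  have map_rad : ∀ a ∈ Ring.jacobson A, ι a ∈ Ring.jacobson H := fun a ha ↦
    h.rad_eq.subset ⟨a, ha, rfl⟩
  have lift_rad : ∀ x ∈ Ring.jacobson H, ∃ a ∈ Ring.jacobson A, ι a = x := fun x hx ↦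
    h.rad_eq.superset hx
  let π : A →+* A ⧸ Ring.jacobson A := Ideal.Quotient.mk _
  let q : H →+* H ⧸ Ring.jacobson H := Ideal.Quotient.mk _
  let j : A ⧸ Ring.jacobson A →+* H ⧸ Ring.jacobson H :=
    Ideal.Quotient.lift _ (q.comp ι) fun a ha ↦ Ideal.Quotient.eq_zero_iff_mem.2 (map_rad a ha)
  have hj : ∀ a, j (π a) = q (ι a) := fun _ ↦ rfl
  have hπ : ∀ a, π a = 0 ↔ a ∈ Ring.jacobson A := fun _ ↦ Ideal.Quotient.eq_zero_iff_mem
  have hq : ∀ x, q x = 0 ↔ x ∈ Ring.jacobson H := fun _ ↦ Ideal.Quotient.eq_zero_iff_mem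
  have hπs : Function.Surjective π := Ideal.Quotient.mk_surjective
  have hqs : Function.Surjective q := Ideal.Quotient.mk_surjective
  -- `W` is isomorphic to `e R`, where `R = A / rad A`.
  have := IsSimpleModule.nontrivial Aᵐᵒᵖ W
  obtain ⟨w, hw⟩ := exists_ne (0 : W)
  obtain ⟨e, he, hew⟩ := exists_idempotent_annihilator π hπs w fun a ha ↦
    op_smul_eq_zero_of_mem_jacobson ((hπ a).1 ha) w
  have hew' : ∀ a b, MulOpposite.op a • w = MulOpposite.op b • w ↔ e * π a = e * π b := by
    intro a b
    rw [← sub_eq_zero, ← sub_smul, ← MulOpposite.op_sub, hew, map_sub, mul_sub, sub_eq_zero]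
  have hgen : ∀ w' : W, w' ≠ 0 → ∀ u : W, ∃ a : A, MulOpposite.op a • w' = u := fun w' hw' u ↦
    (IsSimpleModule.toSpanSingleton_surjective Aᵐᵒᵖ hw' u).imp' MulOpposite.unop fun _ ha ↦ ha
  -- The embedding `l` of `W` into `R`, with image `e R`, sends `w` to `e`.
  choose c hc using hgen w hw
  let l : W →+ A ⧸ Ring.jacobson A := AddMonoidHom.mk' (fun u ↦ e * π (c u)) fun u u' ↦ by
    rw [← mul_add, ← map_add, ← hew', MulOpposite.op_add, add_smul, hc, hc, hc]
  have hl : ∀ a u, l (MulOpposite.op a • u) = l u * π a := fun a u ↦ by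
    change e * _ = e * _ * _
    rw [mul_assoc, ← map_mul, ← hew', MulOpposite.op_mul, mul_smul, hc, hc]
  have hle : ∀ u, e * l u = l u := fun u ↦ by
    change e * (e * _) = e * _
    rw [← mul_assoc, he.eq]
  have hlw : l w = e := by
    have : e * π (c w) = e * π 1 := (hew' _ _).1 (by rw [hc, MulOpposite.op_one, one_smul])
    rwa [map_one, mul_one] at this
  have he0 : e ≠ 0 := fun he0 ↦ hw <| by
    have := (hew 1).2 (by rw [he0, zero_mul])
    rwa [MulOpposite.op_one, one_smul] at this
  have hsimple : ∀ r, e * r ≠ 0 → ∃ s, e * r * s = e := by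
    intro r hr
    obtain ⟨a, rfl⟩ := hπs r
    obtain ⟨b, hb⟩ := hgen _ (mt (hew a).1 hr) w
    refine ⟨π b, ?_⟩
    have := (hew' (a * b) 1).1 (by
      rw [MulOpposite.op_mul, mul_smul, hb, MulOpposite.op_one, one_smul])
    rwa [map_mul, map_one, mul_one, ← mul_assoc] at this
  refine ⟨Submodule.span A {e}, inferInstance, inferInstance,
    isSimpleModule_span_idempotent he he0 hsimple, ?_⟩
  obtain ⟨t, t_comm, t_dual⟩ := exists_symmetrizing_form k (H ⧸ Ring.jacobson H)
  let := rightTensorModule (ι : A →+* H) W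
  let := leftTensorModule (ι : A →+* H) (Submodule.span A {e})
  let f : LeftTensor (ι : A →+* H) (Submodule.span A {e}) →+ H ⧸ Ring.jacobson H :=
    leftLift _ ((AddMonoidHom.mul.comp q.toAddMonoidHom).compl₂
      (j.toAddMonoidHom.comp (Submodule.span A {e}).subtype.toAddMonoidHom)) (by
        rintro x a ⟨r, hr⟩
        change q (x * ι a) * j r = q x * j (a • r)
        obtain ⟨r, rfl⟩ := hπs r
        change _ = q x * j (π (a * r))
        rw [map_mul, map_mul, map_mul, mul_assoc]
        rfl)
  have hf : ∀ x u, f (leftMk _ x u) = q x * j u := fun _ _ ↦ rfl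
  let g : RightTensor (ι : A →+* H) W →+ H ⧸ Ring.jacobson H :=
    rightLift _ ((AddMonoidHom.mul.comp (j.toAddMonoidHom.comp l)).compl₂ q.toAddMonoidHom) (by
        intro u a x
        change j (l _) * q x = j (l u) * q (ι a * x)
        rw [hl, map_mul, map_mul, mul_assoc, hj])
  have hg : ∀ u x, g (rightMk _ u x) = j (l u) * q x := fun _ _ ↦ rfl
  refine length_le_of_symmetrizing_form t t_comm t_dual (q.comp (ι : A →+* H))
    (fun c ↦ ⟨algebraMap k A c, ?_⟩) (j e) f (fun a z ↦ ?_) (fun s ↦ ?_) g (fun a z ↦ ?_) ?_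
    (fun z ↦ ?_)
  · exact congrArg q (ι.commutes c)
  · induction z using leftTensor_induction with
    | h0 => simp
    | hmk x u =>
      rw [smul_leftMk, hf, hf, map_mul, mul_assoc]; rfl
    | hadd x y hx hy => rw [map_add, smul_add, map_add, hx, hy, mul_add]
  · obtain ⟨x, rfl⟩ := hqs s
    exact ⟨leftMk _ x ⟨e, Submodule.mem_span_singleton_self e⟩, rfl⟩
  · induction z using rightTensor_induction with
    | h0 => simp
    | hmk u x =>
      rw [smul_rightMk, hg, hg, map_mul, mul_assoc]; rfl
    | hadd x y hx hy => rw [map_add, smul_add, map_add, hx, hy, add_mul]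
  · -- Every element is `w ⊗ x`, and if `e x` lies in the radical it comes from the radical of `A`.
    have pure : ∀ z : RightTensor (ι : A →+* H) W, ∃ x, z = rightMk _ w x := by
      intro z
      induction z using rightTensor_induction with
      | h0 => exact ⟨0, ((rightMkHom (ι : A →+* H) w).map_zero).symm⟩
      | hmk u x => exact ⟨ι (c u) * x, ((rightMk_mul _ w (c u) x).trans (by rw [hc])).symm⟩
      | hadd x y hx hy =>
        obtain ⟨x, rfl⟩ := hx
        obtain ⟨y, rfl⟩ := hy
        exact ⟨x + y, ((rightMkHom (ι : A →+* H) w).map_add x y).symm⟩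
    refine (injective_iff_map_eq_zero g).2 fun z hz ↦ ?_
    obtain ⟨x, rfl⟩ := pure z
    obtain ⟨a, ha⟩ := hπs e
    rw [hg, hlw, ← ha, hj, ← map_mul, hq] at hz
    obtain ⟨b, hb, hbx⟩ := lift_rad _ hz
    have haw : MulOpposite.op a • w = w := by
      have := (hew' a 1).2 (by rw [ha, he.eq, map_one, mul_one])
      rwa [MulOpposite.op_one, one_smul] at this
    calc rightMk (ι : A →+* H) w x = rightMk _ (MulOpposite.op a • w) x := by rw [haw]
      _ = rightMk _ w ((ι : A →+* H) b * 1) := by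
        rw [← rightMk_mul, mul_one]; exact congrArg _ hbx.symm
      _ = rightMkHom (ι : A →+* H) (MulOpposite.op b • w) 1 := rightMk_mul _ w b 1
      _ = 0 := by rw [op_smul_eq_zero_of_mem_jacobson hb, map_zero, AddMonoidHom.zero_apply]
  · induction z using rightTensor_induction with
    | h0 => simp
    | hmk u x => rw [hg, ← mul_assoc, ← map_mul, hle]
    | hadd x y hx hy => rw [map_add, mul_add, hx, hy]

theorem IsRadicalEmbedding.op {ι : A →ₐ[k] H} (h : IsRadicalEmbedding ι) :
    IsRadicalEmbedding (AlgHom.op ι) := by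
  have := h.finite
  have map_rad : ∀ a ∈ Ring.jacobson A, ι a ∈ Ring.jacobson H := fun a ha ↦
    h.rad_eq.subset ⟨a, ha, rfl⟩
  refine ⟨Module.Finite.equiv (MulOpposite.opLinearEquiv k), h.hereditary.op (k := k),
    fun a b hab ↦ MulOpposite.unop_injective (h.injective (MulOpposite.op_injective hab)), ?_, ?_⟩
  · intro x hx
    obtain ⟨a, ha⟩ := h.rad_subset (op_mem_jacobson_iff.1 hx : x.unop ∈ _)
    exact ⟨.op a, MulOpposite.unop_injective ha⟩
  · refine Set.Subset.antisymm ?_ fun x hx ↦ ?_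
    · rintro _ ⟨a, ha, rfl⟩
      exact op_mem_jacobson (map_rad a.unop (op_mem_jacobson_iff.1 ha))
    · obtain ⟨a, ha, hax⟩ := h.rad_eq.superset (op_mem_jacobson_iff.1 hx : x.unop ∈ _)
      exact ⟨.op a, op_mem_jacobson ha, MulOpposite.unop_injective hax⟩

theorem IsNodalIn.isRightNodalIn [IsAlgClosed k] {ι : A →ₐ[k] H} (h : IsNodalIn ι) :
    IsRightNodalIn ι where
  __ := h.toIsRadicalEmbedding
  length_le W _ _ _ := by
    obtain ⟨U, _, _, hU, hle⟩ := h.toIsRadicalEmbedding.exists_rightLength_le W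
    exact hle.trans (h.length_le U hU)

theorem IsRightNodalIn.op {ι : A →ₐ[k] H} (h : IsRightNodalIn ι) : IsNodalIn (AlgHom.op ι) where
  __ := h.toIsRadicalEmbedding.op
  length_le U _ _ hU := (leftLength_op_le (ι : A →+* H) U).trans (h.length_le U hU)

/-- Both conditions are exchanged on passing to opposite algebras, so that this follows from
`IsNodalIn.isRightNodalIn` for the opposite embedding. -/
theorem IsRightNodalIn.isNodalIn [IsAlgClosed k] {ι : A →ₐ[k] H} (h : IsRightNodalIn ι) :
    IsNodalIn ι where
  __ := h.toIsRadicalEmbedding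
  length_le U _ _ _ :=
    let := doubleOpModule A U
    (leftLength_le_rightLength_op (ι : A →+* H) U).trans
      (h.op.isRightNodalIn.length_le U (isSimpleModule_doubleOp U))

end Comparison

end NodalAlg

theorem corollary1p7 (k : Type u) [Field k] [IsAlgClosed k]
    (A : Type v) [Ring A] [Algebra k A] [Module.Finite k A] :
    (NodalAlg.IsNodal k A → NodalAlg.IsNodal k Aᵐᵒᵖ) ∧
    (NodalAlg.IsNodal k A ↔ NodalAlg.IsRightNodal k A) ∧
    (∀ (H : Type w) [Ring H] [Algebra k H] (ι : A →ₐ[k] H),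
      NodalAlg.IsNodalIn ι ↔ NodalAlg.IsRightNodalIn ι) := by
  refine ⟨?_, ⟨?_, ?_⟩, fun H _ _ ι ↦ ⟨fun h ↦ h.isRightNodalIn, fun h ↦ h.isNodalIn⟩⟩
  · rintro ⟨H, _, _, ι, h⟩
    exact ⟨Hᵐᵒᵖ, inferInstance, inferInstance, AlgHom.op ι, h.isRightNodalIn.op⟩
  · rintro ⟨H, _, _, ι, h⟩
    exact ⟨H, _, _, ι, h.isRightNodalIn⟩
  · rintro ⟨H, _, _, ι, h⟩
    exact ⟨H, _, _, ι, h.isNodalIn⟩
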